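/- Let $M$ be a type $\mathrm{II}_1$ factor, acting as a von Neumann algebra on some complex Hilbert space, which is separable (that is, its predual $M_*$, the space of normal linear functionals on $M$, is norm separable). Let $\tau$ be a normal faithful trace on $M$, normalized by $\tau(1)=1$. Let $L^2(M,\tau)$ be the completion of $M$ for the inner product $\langle x,y\rangle=\tau(y^*x)$, let $\hat x\in L^2(M,\tau)$ be the vector represented by $x\in M$, and let $M$ act on $L^2(M,\tau)$ by extending left multiplication. Then there is a sequence $(s_n)_{n\in\mathbb N}$ of self-adjoint unitaries in $M$ such that $(\hat s_n)_{n\in\mathbb N}$ is an orthonormal basis of $L^2(M,\tau)$ and every $\hat s_n$ is a trace vector, that is, $\langle x\hat s_n,\hat s_n\rangle=\tau(x)$ for all $x\in M$. -/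

import Mathlib

open scoped ComplexOrder InnerProductSpace

namespace VonNeumannAlgebra

variable {H : Type*} [NormedAddCommGroup H] [InnerProductSpace ℂ H] [CompleteSpace H]

/-! The algebra of elements of `M` is the type `M.toStarSubalgebra`; with the operator norm, the
adjoint and the order of operators inherited from `H →L[ℂ] H` it is an ordered C⋆-algebra. -/

instance instIsClosedToStarSubalgebra (M : VonNeumannAlgebra H) :
    IsClosed (M.toStarSubalgebra : Set (H →L[ℂ] H)) := by
  rw [coe_toStarSubalgebra, ← centralizer_centralizer M]
  exact Set.isClosed_centralizer _

instance instStarOrderedRingToStarSubalgebra (M : VonNeumannAlgebra H) :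
    StarOrderedRing M.toStarSubalgebra := by
  refine StarOrderedRing.of_nonneg_iff' ?_ ?_
  · intro x y hxy z
    have h : (x : H →L[ℂ] H) ≤ y := hxy
    change (z : H →L[ℂ] H) + x ≤ z + y
    exact add_le_add_right h _
  · intro x
    constructor
    · intro hx
      have h : (0 : H →L[ℂ] H) ≤ x := hx
      have hsa : IsSelfAdjoint (x : H →L[ℂ] H) := .of_nonneg h
      have hmem : cfc Real.sqrt (x : H →L[ℂ] H) ∈ M.toStarSubalgebra :=
        cfc_mem (𝕜 := ℝ) Real.sqrt x.2
      refine ⟨⟨_, hmem⟩, Subtype.ext ?_⟩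
      have hs : IsSelfAdjoint (cfc Real.sqrt (x : H →L[ℂ] H)) := cfc_predicate _ _
      change (x : H →L[ℂ] H) = star (cfc Real.sqrt (x : H →L[ℂ] H)) * cfc Real.sqrt (x : H →L[ℂ] H)
      rw [hs.star_eq, ← cfc_mul Real.sqrt Real.sqrt (x : H →L[ℂ] H)]
      conv_lhs => rw [← cfc_id ℝ (x : H →L[ℂ] H)]
      refine cfc_congr fun t ht => ?_
      have : 0 ≤ t := spectrum_nonneg_of_nonneg h ht
      simp [Real.mul_self_sqrt this]
    · rintro ⟨s, rfl⟩
      exact star_mul_self_nonneg (s : H →L[ℂ] H)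

/-- A functional on `M` is normal (ultraweakly continuous) if it is of the form
`x ↦ ∑ ⟨x ξₙ, ηₙ⟩` with `∑ ‖ξₙ‖² < ∞` and `∑ ‖ηₙ‖² < ∞`. -/
def IsNormal (M : VonNeumannAlgebra H) (φ : M.toStarSubalgebra → ℂ) : Prop :=
  ∃ ξ η : ℕ → H, Summable (fun n => ‖ξ n‖ ^ 2) ∧ Summable (fun n => ‖η n‖ ^ 2) ∧
    ∀ x : M.toStarSubalgebra, HasSum (fun n => ⟪η n, (x : H →L[ℂ] H) (ξ n)⟫_ℂ) (φ x)

/-- The predual of `M`, as a set of bounded functionals: all normal functionals. -/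
def predual (M : VonNeumannAlgebra H) : Set (StrongDual ℂ M.toStarSubalgebra) :=
  {φ | M.IsNormal φ}

/-- `M` is separable if its predual is separable for the norm of functionals. -/
def IsSeparable (M : VonNeumannAlgebra H) : Prop :=
  TopologicalSpace.IsSeparable M.predual

/-- A factor is a nonzero von Neumann algebra whose center consists of the scalars. -/
def IsFactor (M : VonNeumannAlgebra H) : Prop :=
  Nontrivial M.toStarSubalgebra ∧
    ∀ z ∈ Subring.center M.toStarSubalgebra, ∃ c : ℂ, z = c • 1

/-- `M` is finite if every isometry in `M` is unitary. -/
def IsFinite (M : VonNeumannAlgebra H) : Prop :=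
  ∀ v : M.toStarSubalgebra, star v * v = 1 → v * star v = 1

/-- A projection `e` of `M` is abelian if the algebra `eMe` is commutative. -/
def IsAbelianProjection (M : VonNeumannAlgebra H) (e : M.toStarSubalgebra) : Prop :=
  IsStarProjection e ∧
    ∀ x y : M.toStarSubalgebra, Commute (e * x * e) (e * y * e)

/-- A von Neumann algebra is of type II₁ if it is finite and has no nonzero abelian projection. -/
def IsTypeIIOne (M : VonNeumannAlgebra H) : Prop :=
  M.IsFinite ∧ ∀ e : M.toStarSubalgebra, M.IsAbelianProjection e → e = 0

/-- A type II₁ factor. -/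
def IsTypeIIOneFactor (M : VonNeumannAlgebra H) : Prop :=
  M.IsFactor ∧ M.IsTypeIIOne

/-- A (normalized) normal faithful trace on `M`: a faithful normal tracial state. -/
structure IsNormalFaithfulTrace (M : VonNeumannAlgebra H) (τ : M.toStarSubalgebra →ₚ[ℂ] ℂ) :
    Prop where
  map_one : τ 1 = 1
  map_mul_comm : ∀ x y, τ (x * y) = τ (y * x)
  faithful : ∀ x, τ (star x * x) = 0 → x = 0
  normal : M.IsNormal τ

/-- The Hilbert space `L²(M, τ)`: the completion of `M` for `⟨x, y⟩ = τ(y* x)`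
(Mathlib's inner product is conjugate-linear in its first argument). -/
noncomputable abbrev L2 (M : VonNeumannAlgebra H) (τ : M.toStarSubalgebra →ₚ[ℂ] ℂ) : Type _ :=
  τ.GNS

/-- The vector `x̂` of `L²(M, τ)` represented by `x`. -/
noncomputable def hat (M : VonNeumannAlgebra H) (τ : M.toStarSubalgebra →ₚ[ℂ] ℂ)
    (x : M.toStarSubalgebra) : M.L2 τ :=
  ((τ.toPreGNS x : τ.PreGNS) : UniformSpace.Completion τ.PreGNS)

/-- `ξ ∈ L²(M, τ)` is a trace vector if `⟨x ξ, ξ⟩ = τ(x)` for all `x ∈ M`, where `M` acts on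
`L²(M, τ)` by the extension of left multiplication. -/
def IsTraceVector (M : VonNeumannAlgebra H) (τ : M.toStarSubalgebra →ₚ[ℂ] ℂ) (ξ : M.L2 τ) : Prop :=
  ∀ x : M.toStarSubalgebra, ⟪ξ, τ.gnsStarAlgHom x ξ⟫_ℂ = τ x

end VonNeumannAlgebra

/-!
Every vector `ŝ` with `s` a symmetry (a self-adjoint unitary) is a trace vector, because
`τ(s x s) = τ(x s s) = τ(x)`. So the point is to find symmetries which are orthogonal for `τ` and
have dense linear span in `L²(M, τ)`. They are found greedily, by means of a noncommutative
Lyapunov theorem (`IsNormalFaithfulTrace.hasLyapunovProperty`): for finitely many self-adjoint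
`f i` and a self-adjoint contraction `x` there is a symmetry `s` with `τ(s f i) = τ(x f i)` for
all `i`.

*Lyapunov.* The self-adjoint contractions `y` with `τ(y f i) = τ(x f i)` for all `i` form a set
which is compact for the weak operator topology, as `τ` is normal, so it has an extreme point `y`
(`extremePoints_slice_nonempty`). If `h = 1 - y²` were nonzero, then `hMh` would be infinite
dimensional, because a nonzero projection `p` with `pMp` of minimal finite dimension would be
abelian (`not_finiteDimensional_cornerSpace`). Hence there would be a self-adjoint `w` with
`hwh ≠ 0` and `τ(hwh f i) = 0` for all `i`. For `w` small, `y ± hwh` are still contractions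
(`norm_add_conjugate_le_one`), which contradicts extremality.

*Greedy approximation.* Let `T` be a finite orthogonal system of symmetries and let `r` be the
difference of a self-adjoint `a` and its projection to the span of `T`. Lyapunov's theorem, applied
to a multiple of `r`, yields a symmetry `s` orthogonal to `T` with `τ(s a) = c`, for any given
`0 ≤ c ≤ ‖r‖₂² / ‖r‖`. Adding `s` to `T` lowers `‖r‖₂²` by `c²` and raises the operator norm of `r`
by at most `c`. With `c` proportional to `1 / √n` in the `n`-th step, the operator norms are
`O(√n)`, so that the steps are admissible while `‖r‖₂` is bounded below, which cannot last since
`∑ 1 / n` diverges (`IsSymmetrySystem.exists_symmResidual_lt`).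

Separability of the predual provides a sequence of self-adjoint contractions which is `L²`-dense
among them (`IsNormalFaithfulTrace.exists_seq_dense`). Interleaving the approximations of its terms
gives the basis.
-/

/-! ### Compressions in an algebra without abelian projections -/

section Corner

variable {A : Type*} [CStarAlgebra A]

/-- The subspace `hAh` of `A`. -/
noncomputable def cornerSpace (h : A) : Submodule ℂ A :=
  LinearMap.range (LinearMap.mulLeftRight ℂ (h, h))

theorem mem_cornerSpace {h z : A} : z ∈ cornerSpace h ↔ ∃ w, h * w * h = z := by
  simp [cornerSpace, LinearMap.mem_range]

theorem cornerSpace_le {h k x y : A} (hx : k = h * x) (hy : k = y * h) :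
    cornerSpace k ≤ cornerSpace h := by
  intro z hz
  obtain ⟨w, rfl⟩ := mem_cornerSpace.1 hz
  refine mem_cornerSpace.2 ⟨x * w * y, ?_⟩
  calc h * (x * w * y) * h = (h * x) * w * (y * h) := by simp only [mul_assoc]
    _ = k * w * k := by rw [← hx, ← hy]

/-- If `aAa` is finite dimensional, then `a p(a) a = 0` for some polynomial `p ≠ 0`. -/
theorem spectrum_finite_of_finiteDimensional_cornerSpace {a : A}
    (hfin : FiniteDimensional ℂ (cornerSpace a)) : (spectrum ℝ a).Finite := by
  let L : Polynomial ℂ →ₗ[ℂ] cornerSpace a :=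
    (LinearMap.mulLeftRight ℂ (a, a)).rangeRestrict ∘ₗ (Polynomial.aeval a).toLinearMap
  have hL : ¬ Function.Injective L := fun hinj =>
    Polynomial.not_finite (R := ℂ) (Module.Finite.of_injective L hinj)
  obtain ⟨p, hp, hp0⟩ : ∃ p, L p = 0 ∧ p ≠ 0 := by
    by_contra! hcon
    exact hL ((injective_iff_map_eq_zero L).2 hcon)
  have hpa : a * Polynomial.aeval a p * a = 0 := congrArg Subtype.val hp
  set q : Polynomial ℂ := Polynomial.X * p * Polynomial.X with hq
  have hq0 : q ≠ 0 := by simp [hq, hp0]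
  have hqa : Polynomial.aeval a q = 0 := by simpa [hq] using hpa
  have hC : (spectrum ℂ a).Finite := by
    refine (q.roots.toFinset.finite_toSet).subset fun z hz => ?_
    have h1 := spectrum.subset_polynomial_aeval a q ⟨z, hz, rfl⟩
    rw [hqa] at h1
    have : Nontrivial A := by
      by_contra hn
      rw [not_nontrivial_iff_subsingleton] at hn
      simp [spectrum.of_subsingleton] at hz
    rw [spectrum.zero_eq] at h1
    simpa [hq0] using h1
  rw [← spectrum.preimage_algebraMap ℂ]
  exact hC.preimage (algebraMap ℝ ℂ).injective.injOn

/-- An element of finite spectrum is a combination of its spectral projections, which are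
continuous functions of it. -/
theorem exists_isStarProjection_of_finite_spectrum {b : A} (hb : IsSelfAdjoint b) (hb0 : b ≠ 0)
    (hfin : (spectrum ℝ b).Finite) :
    ∃ (μ : ℝ) (e k : A), IsStarProjection e ∧ e ≠ 0 ∧ e = b * k ∧ e = k * b ∧ b * e = μ • e := by
  obtain ⟨μ, hμ, hμ0⟩ : ∃ μ ∈ spectrum ℝ b, μ ≠ 0 := by
    by_contra! hcon
    refine hb0 ?_
    rw [← cfc_id ℝ b, ← cfc_zero ℝ b]
    exact cfc_congr fun t ht => hcon t ht
  have hcont (f : ℝ → ℝ) : ContinuousOn f (spectrum ℝ b) := hfin.continuousOn f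
  set f : ℝ → ℝ := fun t => if t = μ then 1 else 0 with hf
  set g : ℝ → ℝ := fun t => if t = μ then μ⁻¹ else 0 with hg
  have hbk : cfc f b = b * cfc g b := by
    nth_rewrite 2 [← cfc_id ℝ b]
    rw [← cfc_mul _ _ b (hcont _) (hcont _)]
    refine cfc_congr fun t _ => ?_
    by_cases h : t = μ <;> simp [hf, hg, h, hμ0]
  have hkb : cfc f b = cfc g b * b := by
    nth_rewrite 3 [← cfc_id ℝ b]
    rw [← cfc_mul _ _ b (hcont _) (hcont _)]
    refine cfc_congr fun t _ => ?_
    by_cases h : t = μ <;> simp [hf, hg, h, hμ0]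
  refine ⟨μ, cfc f b, cfc g b, ⟨?_, cfc_predicate f b⟩, ?_, hbk, hkb, ?_⟩
  · rw [IsIdempotentElem, ← cfc_mul _ _ b (hcont _) (hcont _)]
    refine cfc_congr fun t _ => ?_
    by_cases h : t = μ <;> simp [hf, h]
  · intro h0
    have h1 : f μ ∈ spectrum ℝ (cfc f b) := by
      rw [cfc_map_spectrum f b hb (hcont f)]
      exact ⟨μ, hμ, rfl⟩
    have : Nontrivial A := ⟨b, 0, hb0⟩
    rw [h0, spectrum.zero_eq] at h1
    simp [hf] at h1
  · nth_rewrite 1 [← cfc_id ℝ b]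
    rw [← cfc_mul _ _ b (hcont _) (hcont _), ← cfc_smul μ f b (hcont f)]
    refine cfc_congr fun t _ => ?_
    by_cases h : t = μ <;> simp [hf, h]

/-- A nonzero projection `p` with `pAp` of minimal finite dimension is abelian: spectral
projections of self-adjoint elements of `pAp` must be `p` itself, so that `pAp` is scalar. -/
theorem not_finiteDimensional_cornerSpace_of_isStarProjection
    (hA : ∀ e : A, IsStarProjection e → (∀ x y : A, Commute (e * x * e) (e * y * e)) → e = 0)
    (n : ℕ) : ∀ p : A, IsStarProjection p → p ≠ 0 → FiniteDimensional ℂ (cornerSpace p) →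
      Module.finrank ℂ (cornerSpace p) ≠ n := by
  induction n using Nat.strong_induction_on with
  | _ n ih =>
  intro p hp hp0 hfin hn
  have hpp : p * p = p := hp.isIdempotentElem
  have hps : star p = p := hp.isSelfAdjoint
  have key : ∀ a : A, IsSelfAdjoint a → ∃ μ : ℝ, p * a * p = μ • p := by
    intro a ha
    by_cases hb0 : p * a * p = 0
    · exact ⟨0, by simp [hb0]⟩
    set b := p * a * p with hb
    have hbs : IsSelfAdjoint b := by
      rw [IsSelfAdjoint, hb, star_mul, star_mul, hps, ha.star_eq, mul_assoc]
    have hpb : p * b = b := by rw [hb, ← mul_assoc, ← mul_assoc, hpp]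
    have hbp : b * p = b := by rw [hb, mul_assoc, hpp]
    have hble : cornerSpace b ≤ cornerSpace p := cornerSpace_le hpb.symm hbp.symm
    have hbfin : FiniteDimensional ℂ (cornerSpace b) :=
      Submodule.finiteDimensional_of_le hble
    obtain ⟨μ, e, k, he, he0, h1, h2, h3⟩ := exists_isStarProjection_of_finite_spectrum hbs hb0
      (spectrum_finite_of_finiteDimensional_cornerSpace hbfin)
    -- `e = p`, since otherwise `eAe` would be a proper subspace of `pAp`
    have hele : cornerSpace e ≤ cornerSpace p := (cornerSpace_le h1 h2).trans hble
    have hefin : FiniteDimensional ℂ (cornerSpace e) := Submodule.finiteDimensional_of_le hele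
    have heq : cornerSpace e = cornerSpace p := by
      refine Submodule.eq_of_le_of_finrank_le hele ?_
      by_contra! hlt
      exact ih _ (hn ▸ hlt) e he he0 hefin rfl
    have hpe : e = p := by
      have hmem : p ∈ cornerSpace e := by
        rw [heq]
        exact mem_cornerSpace.2 ⟨1, by simp [hpp]⟩
      obtain ⟨w, hw⟩ := mem_cornerSpace.1 hmem
      have hep : e * p = p := by
        rw [← hw, ← mul_assoc, ← mul_assoc, he.isIdempotentElem.eq]
      rw [← hep, h2, mul_assoc, hbp]
    refine ⟨μ, ?_⟩
    rw [hpe, hbp] at h3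
    exact h3
  have key' : ∀ a : A, ∃ c : ℂ, p * a * p = c • p := by
    intro a
    obtain ⟨μ, hμ⟩ := key (realPart a) (realPart a).2
    obtain ⟨ν, hν⟩ := key (imaginaryPart a) (imaginaryPart a).2
    refine ⟨μ + Complex.I * ν, ?_⟩
    conv_lhs => rw [← realPart_add_I_smul_imaginaryPart a]
    rw [mul_add, add_mul, hμ, mul_smul_comm, smul_mul_assoc, hν, add_smul, mul_smul]
    simp
  refine hp0 (hA p hp fun x y => ?_)
  obtain ⟨c, hc⟩ := key' x
  obtain ⟨d, hd⟩ := key' y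
  rw [hc, hd]
  exact ((Commute.refl p).smul_left c).smul_right d

/-- Without nonzero abelian projections, `hAh` is infinite dimensional for `h ≠ 0`. -/
theorem not_finiteDimensional_cornerSpace
    (hA : ∀ e : A, IsStarProjection e → (∀ x y : A, Commute (e * x * e) (e * y * e)) → e = 0)
    {h : A} (hs : IsSelfAdjoint h) (h0 : h ≠ 0) : ¬ FiniteDimensional ℂ (cornerSpace h) := by
  intro hfin
  obtain ⟨μ, e, k, he, he0, h1, h2, -⟩ := exists_isStarProjection_of_finite_spectrum hs h0
    (spectrum_finite_of_finiteDimensional_cornerSpace hfin)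
  exact not_finiteDimensional_cornerSpace_of_isStarProjection hA _ e he he0
    (Submodule.finiteDimensional_of_le (cornerSpace_le h1 h2)) rfl

end Corner

/-! ### Extreme points of slices of the unit ball are symmetries -/

section Perturbation

variable {A : Type*} [CStarAlgebra A] [PartialOrder A] [StarOrderedRing A]

theorem norm_le_one_of_neg_one_le_of_le_one {y : A} (hs : IsSelfAdjoint y) (h1 : -1 ≤ y)
    (h2 : y ≤ 1) : ‖y‖ ≤ 1 := by
  have hc : Commute (1 - y) (1 + y) := by
    rw [commute_iff_eq]; noncomm_ring
  have h3 : 0 ≤ (1 - y) * (1 + y) :=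
    hc.mul_nonneg (sub_nonneg.2 h2) (by simpa [add_comm] using sub_nonneg.2 h1)
  have h4 : y * y ≤ 1 := by
    rw [← sub_nonneg]
    convert h3 using 1
    noncomm_ring
  have h5 := (CStarAlgebra.norm_le_one_iff_of_nonneg (y * y) hs.mul_self_nonneg).2 h4
  rw [hs.norm_mul_self] at h5
  exact (sq_le_one_iff₀ (norm_nonneg y)).1 h5

theorem aeval_nonneg_of_norm_le_one {y : A} (hs : IsSelfAdjoint y) (hn : ‖y‖ ≤ 1)
    (q : Polynomial ℝ) (hq : ∀ t ∈ Set.Icc (-1 : ℝ) 1, 0 ≤ q.eval t) :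
    0 ≤ Polynomial.aeval y q := by
  rw [← cfc_polynomial q y hs]
  refine cfc_nonneg fun t ht => hq t ?_
  have : Nontrivial A := by
    by_contra hn
    rw [not_nontrivial_iff_subsingleton] at hn
    simp [spectrum.of_subsingleton] at ht
  have h1 := (spectrum.norm_le_norm_of_mem ht).trans hn
  exact abs_le.1 h1

/-- If `h = 1 - y²` and `w` is small, then `hwh ≤ ‖w‖ h²` is dominated by both `1 - y` and
`1 + y`. -/
theorem norm_add_conjugate_le_one {y w : A} (hs : IsSelfAdjoint y) (hn : ‖y‖ ≤ 1)
    (hw : IsSelfAdjoint w) (hwn : ‖w‖ ≤ 1 / 4) :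
    ‖y + (1 - y * y) * w * (1 - y * y)‖ ≤ 1 := by
  set h := 1 - y * y with hh
  have hhs : IsSelfAdjoint h := .sub (.one A)
    (by simpa [hs.star_eq] using IsSelfAdjoint.star_mul_self y)
  have hquart : ∀ v : A, IsSelfAdjoint v → ‖v‖ ≤ 1 / 4 → h * v * h ≤ (1 / 4 : ℝ) • (h * h) := by
    intro v hv hvn
    have h1 : v ≤ (1 / 4 : ℝ) • (1 : A) := by
      refine (hv.le_algebraMap_norm_self).trans ?_
      rw [← Algebra.algebraMap_eq_smul_one]
      exact algebraMap_mono A hvn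
    have h2 := star_left_conjugate_le_conjugate h1 h
    rw [hhs.star_eq] at h2
    simpa using h2
  -- `(1 - t) - (1 - t²)² / 4 = (1 - t) (4 - (1 - t) (1 + t)²) / 4`
  have hp1 := aeval_nonneg_of_norm_le_one hs hn
    (1 - Polynomial.X - Polynomial.C (1 / 4) * ((1 - Polynomial.X * Polynomial.X) *
      (1 - Polynomial.X * Polynomial.X))) (by
        rintro t ⟨ht1, ht2⟩
        simp
        have : 0 ≤ (1 - t) * (4 - (1 - t) * (1 + t) ^ 2) := by
          refine mul_nonneg (by linarith) ?_
          nlinarith [mul_nonneg (sub_nonneg.2 ht2) (sub_nonneg.2 ht1), sq_nonneg (1 + t)]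
        nlinarith)
  have hp2 := aeval_nonneg_of_norm_le_one hs hn
    (1 + Polynomial.X - Polynomial.C (1 / 4) * ((1 - Polynomial.X * Polynomial.X) *
      (1 - Polynomial.X * Polynomial.X))) (by
        rintro t ⟨ht1, ht2⟩
        simp
        have : 0 ≤ (1 + t) * (4 - (1 + t) * (1 - t) ^ 2) := by
          refine mul_nonneg (by linarith) ?_
          nlinarith [mul_nonneg (sub_nonneg.2 ht2) (sub_nonneg.2 ht1), sq_nonneg (1 - t)]
        nlinarith)
  simp only [map_sub, map_add, map_mul, map_one, Polynomial.aeval_X, Polynomial.aeval_C, ← hh,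
    ← Algebra.smul_def, sub_nonneg] at hp1 hp2
  have hz : IsSelfAdjoint (h * w * h) := by
    simpa [hhs.star_eq] using hw.conjugate h
  refine norm_le_one_of_neg_one_le_of_le_one (hs.add hz) ?_ ?_
  · have h3 := (hquart (-w) hw.neg (by rwa [norm_neg])).trans hp2
    rw [mul_neg, neg_mul] at h3
    rw [neg_le_iff_add_nonneg]
    rw [neg_le_iff_add_nonneg] at h3
    convert h3 using 1
    abel
  · have h3 := (hquart w hw hwn).trans hp1
    rwa [le_sub_iff_add_le, add_comm] at h3

variable {τ : A →ₚ[ℂ] ℂ}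

theorem map_mul_eq_star_of_trace (htr : ∀ x y, τ (x * y) = τ (y * x)) {f : A}
    (hf : IsSelfAdjoint f) (z : A) : τ (star z * f) = star (τ (z * f)) := by
  rw [htr z f, ← map_star, star_mul, hf.star_eq]

/-- Since `hAh` is infinite dimensional, it contains nonzero self-adjoint elements satisfying
finitely many linear conditions. -/
theorem exists_conjugate_ne_zero
    (hA : ∀ e : A, IsStarProjection e → (∀ x y : A, Commute (e * x * e) (e * y * e)) → e = 0)
    (htr : ∀ x y, τ (x * y) = τ (y * x)) {ι : Type*} [Finite ι] {f : ι → A}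
    (hf : ∀ i, IsSelfAdjoint (f i)) {h : A} (hs : IsSelfAdjoint h) (h0 : h ≠ 0) :
    ∃ w : A, IsSelfAdjoint w ∧ h * w * h ≠ 0 ∧ ∀ i, τ (h * w * h * f i) = 0 := by
  let L : cornerSpace h →ₗ[ℂ] (ι → ℂ) := LinearMap.pi fun i =>
    τ.toLinearMap ∘ₗ LinearMap.mulRight ℂ (f i) ∘ₗ (cornerSpace h).subtype
  have hL : ¬ Function.Injective L := fun hinj =>
    not_finiteDimensional_cornerSpace hA hs h0 (Module.Finite.of_injective L hinj)
  obtain ⟨⟨z, hzmem⟩, hz, hz0⟩ : ∃ p, L p = 0 ∧ p ≠ 0 := by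
    by_contra! hcon
    exact hL ((injective_iff_map_eq_zero L).2 hcon)
  obtain ⟨w, rfl⟩ := mem_cornerSpace.1 hzmem
  have hz' : ∀ i, τ (h * w * h * f i) = 0 := fun i => congrFun hz i
  have hz0' : h * w * h ≠ 0 := fun h1 => hz0 (Subtype.ext h1)
  have hzs : ∀ i, τ (h * star w * h * f i) = 0 := fun i => by
    have := map_mul_eq_star_of_trace htr (hf i) (h * w * h)
    rwa [hz' i, star_mul, star_mul, hs.star_eq, star_zero, ← mul_assoc] at this
  -- `τ(· f i)` vanishes at `hwh` and its adjoint, hence at its real and imaginary parts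
  by_contra! hcon
  have hre : h * (realPart w : A) * h = 0 := by
    by_contra h1
    obtain ⟨i, hi⟩ := hcon _ (realPart w).2 h1
    refine hi ?_
    rw [realPart_apply_coe, mul_smul_comm, mul_add]
    simp [add_mul, ← Complex.coe_smul, hz', hzs]
  have him : h * (imaginaryPart w : A) * h = 0 := by
    by_contra h1
    obtain ⟨i, hi⟩ := hcon _ (imaginaryPart w).2 h1
    refine hi ?_
    rw [imaginaryPart_apply_coe]
    simp [mul_sub, sub_mul, ← Complex.coe_smul, hz', hzs]
  apply hz0'
  rw [← realPart_add_I_smul_imaginaryPart w, mul_add, add_mul, hre, mul_smul_comm, smul_mul_assoc,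
    him]
  simp

/-- Extreme points of a slice of the self-adjoint unit ball by finitely many functionals are
symmetries: otherwise `h = 1 - y²` is nonzero and `y` is the midpoint of `y ± hwh`. -/
theorem mul_self_eq_one_of_mem_extremePoints
    (hA : ∀ e : A, IsStarProjection e → (∀ x y : A, Commute (e * x * e) (e * y * e)) → e = 0)
    (htr : ∀ x y, τ (x * y) = τ (y * x)) {ι : Type*} [Finite ι] {f : ι → A}
    (hf : ∀ i, IsSelfAdjoint (f i)) {c : ι → ℂ} {y : A}
    (hy : y ∈ {y : A | IsSelfAdjoint y ∧ ‖y‖ ≤ 1 ∧ ∀ i, τ (y * f i) = c i}.extremePoints ℝ) :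
    y * y = 1 := by
  obtain ⟨⟨hs, hn, hc⟩, hext⟩ := mem_extremePoints_iff_left.1 hy
  by_contra hne
  set h := 1 - y * y with hh
  have hhs : IsSelfAdjoint h := .sub (.one A)
    (by simpa [hs.star_eq] using IsSelfAdjoint.star_mul_self y)
  have h0 : h ≠ 0 := fun h1 => hne (sub_eq_zero.1 h1).symm
  obtain ⟨w, hw, hwne, hwf⟩ := exists_conjugate_ne_zero hA htr hf hhs h0
  have hw0 : w ≠ 0 := fun h1 => hwne (by simp [h1])
  have hwpos : 0 < ‖w‖ := norm_pos_iff.2 hw0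
  set t : ℝ := 1 / (4 * ‖w‖) with ht
  have htpos : 0 < t := by positivity
  have hmem : ∀ r : ℝ, |r| = t → y + h * (r • w) * h ∈
      {y : A | IsSelfAdjoint y ∧ ‖y‖ ≤ 1 ∧ ∀ i, τ (y * f i) = c i} := by
    intro r hr
    have hrw : IsSelfAdjoint (r • w) := (IsSelfAdjoint.all r).smul hw
    refine ⟨hs.add (by simpa [hhs.star_eq] using hrw.conjugate h),
      norm_add_conjugate_le_one hs hn hrw ?_, fun i => ?_⟩
    · rw [norm_smul, Real.norm_eq_abs, hr, ht]
      exact le_of_eq (by field_simp)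
    · rw [add_mul, map_add, hc i, mul_smul_comm, smul_mul_assoc, smul_mul_assoc,
        ← Complex.coe_smul, map_smul, hwf i, smul_zero, add_zero]
  have h1 := hext _ (hmem t (abs_of_pos htpos)) _ (hmem (-t) (by rw [abs_neg, abs_of_pos htpos]))
    ⟨1 / 2, 1 / 2, by norm_num, by norm_num, by norm_num, by
      simp only [neg_smul, mul_neg, neg_mul]
      module⟩
  rw [add_eq_left, mul_smul_comm, smul_mul_assoc, smul_eq_zero] at h1
  exact h1.elim htpos.ne' hwne

end Perturbation

/-! ### Weak operator compactness of the unit ball -/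

namespace VonNeumannAlgebra

variable {H : Type*} [NormedAddCommGroup H] [InnerProductSpace ℂ H] [CompleteSpace H]

/-- The sesquilinear form of an operator in `M`, as a function on `H × H`. Pointwise convergence
of these functions is weak operator convergence. -/
noncomputable def sesqForm (M : VonNeumannAlgebra H) :
    M.toStarSubalgebra →ₗ[ℝ] (H × H → ℂ) where
  toFun y p := ⟪(y : H →L[ℂ] H) p.1, p.2⟫_ℂ
  map_add' x y := by ext p; simp
  map_smul' r y := by ext p; simp [← Complex.coe_smul, mul_comm]

theorem sesqForm_apply (M : VonNeumannAlgebra H) (y : M.toStarSubalgebra) (p : H × H) :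
    M.sesqForm y p = ⟪(y : H →L[ℂ] H) p.1, p.2⟫_ℂ := rfl

theorem sesqForm_injective (M : VonNeumannAlgebra H) : Function.Injective M.sesqForm := by
  intro x y hxy
  refine Subtype.ext (ContinuousLinearMap.ext fun v => ext_inner_right ℂ fun w => ?_)
  exact congrFun hxy (v, w)

/-- The pointwise bounded, sesquilinear and hermitian functions that commute with `M'`: the forms
of the self-adjoint elements of the unit ball of `M`. -/
def ballForms (M : VonNeumannAlgebra H) : Set (H × H → ℂ) :=
  {B | (∀ p, ‖B p‖ ≤ ‖p.1‖ * ‖p.2‖) ∧ (∀ u v w, B (u, v + w) = B (u, v) + B (u, w)) ∧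
    (∀ (c : ℂ) u v, B (u, c • v) = c * B (u, v)) ∧ (∀ u v, B (v, u) = star (B (u, v))) ∧
    ∀ g ∈ M.commutant, ∀ u v, B (g u, v) = B (u, star g v)}

theorem isCompact_ballForms (M : VonNeumannAlgebra H) : IsCompact M.ballForms := by
  have hbox : IsCompact (Set.univ.pi fun p : H × H => Metric.closedBall (0 : ℂ) (‖p.1‖ * ‖p.2‖)) :=
    isCompact_univ_pi fun p => isCompact_closedBall _ _
  refine hbox.of_isClosed_subset ?_ fun B hB p _ => by simpa using hB.1 p
  simp only [ballForms, Set.ofPred_and, Set.ofPred_forall]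
  refine .inter ?_ (.inter ?_ (.inter ?_ (.inter ?_ ?_)))
  · exact isClosed_iInter fun p => isClosed_le (by fun_prop) (by fun_prop)
  · exact isClosed_iInter fun u => isClosed_iInter fun v => isClosed_iInter fun w =>
      isClosed_eq (by fun_prop) (by fun_prop)
  · exact isClosed_iInter fun u => isClosed_iInter fun v => isClosed_iInter fun w =>
      isClosed_eq (by fun_prop) (by fun_prop)
  · exact isClosed_iInter fun u => isClosed_iInter fun v =>
      isClosed_eq (by fun_prop) (by fun_prop)
  · exact isClosed_iInter fun g => isClosed_iInter fun _ => isClosed_iInter fun u =>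
      isClosed_iInter fun v => isClosed_eq (by fun_prop) (by fun_prop)

/-- By the Riesz representation theorem a form in `ballForms` comes from an operator, which lies in
`M` as it commutes with `M'`. -/
theorem exists_sesqForm_eq (M : VonNeumannAlgebra H) {B : H × H → ℂ} (hB : B ∈ M.ballForms) :
    ∃ y : M.toStarSubalgebra, IsSelfAdjoint y ∧ ‖y‖ ≤ 1 ∧ M.sesqForm y = B := by
  obtain ⟨hb, hadd, hsmul, hherm, hcomm⟩ := hB
  have hadd' : ∀ u v w, B (u + v, w) = B (u, w) + B (v, w) := fun u v w => by
    rw [hherm w, hadd, star_add, ← hherm, ← hherm]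
  have hsmul' : ∀ (c : ℂ) u v, B (c • u, v) = star c * B (u, v) := fun c u v => by
    rw [hherm v, hsmul, star_mul', ← hherm]
  let F : H →L⋆[ℂ] H →L[ℂ] ℂ := LinearMap.mkContinuous₂
    (LinearMap.mk₂'ₛₗ (starRingEnd ℂ) (RingHom.id ℂ) (fun u v => B (u, v)) hadd'
      (fun c u v => hsmul' c u v) hadd (fun c u v => hsmul c u v)) 1
    (fun u v => by simpa using hb (u, v))
  let y : H →L[ℂ] H := InnerProductSpace.continuousLinearMapOfBilin F
  have hy : ∀ u v, ⟪y u, v⟫_ℂ = B (u, v) := fun u v =>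
    InnerProductSpace.continuousLinearMapOfBilin_apply F u v
  have hys : IsSelfAdjoint y := by
    rw [ContinuousLinearMap.isSelfAdjoint_iff_isSymmetric]
    intro u v
    change ⟪y u, v⟫_ℂ = ⟪u, y v⟫_ℂ
    rw [← inner_conj_symm u, hy, hy, hherm v u]
    rfl
  have hyn : ‖y‖ ≤ 1 := by
    refine ContinuousLinearMap.opNorm_le_bound _ zero_le_one fun u => ?_
    have h1 : ‖y u‖ ^ 2 ≤ ‖u‖ * ‖y u‖ := by
      have h2 := hb (u, y u)
      rw [← hy, inner_self_eq_norm_sq_to_K] at h2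
      simpa using h2
    rcases (norm_nonneg (y u)).eq_or_lt with h | h
    · rw [← h]; positivity
    · nlinarith
  have hmem : y ∈ M.toStarSubalgebra := by
    change y ∈ M
    rw [← M.commutant_commutant, mem_commutant_iff]
    intro g hg
    refine ContinuousLinearMap.ext fun u => ext_inner_right ℂ fun v => ?_
    change ⟪g (y u), v⟫_ℂ = ⟪y (g u), v⟫_ℂ
    rw [hy, hcomm g hg, ← hy, ContinuousLinearMap.star_eq_adjoint,
      ContinuousLinearMap.adjoint_inner_right]
  exact ⟨⟨y, hmem⟩, Subtype.ext hys, hyn, funext fun p => hy p.1 p.2⟩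

theorem sesqForm_mem_ballForms (M : VonNeumannAlgebra H) {y : M.toStarSubalgebra}
    (hs : IsSelfAdjoint y) (hn : ‖y‖ ≤ 1) : M.sesqForm y ∈ M.ballForms := by
  have hs' : IsSelfAdjoint (y : H →L[ℂ] H) := congrArg Subtype.val hs
  have hn' : ‖(y : H →L[ℂ] H)‖ ≤ 1 := hn
  refine ⟨fun p => ?_, fun u v w => ?_, fun c u v => ?_, fun u v => ?_, fun g hg u v => ?_⟩
  · rw [sesqForm_apply]
    refine (norm_inner_le_norm _ _).trans ?_
    gcongr
    simpa using (y : H →L[ℂ] H).le_of_opNorm_le hn' p.1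
  · simp [sesqForm_apply]
  · simp [sesqForm_apply]
  · simp only [sesqForm_apply]
    rw [← ContinuousLinearMap.adjoint_inner_right, ← ContinuousLinearMap.star_eq_adjoint,
      hs'.star_eq, ← inner_conj_symm]
    rfl
  · have h1 := (mem_commutant_iff.1 hg) y y.2
    simp only [sesqForm_apply]
    rw [ContinuousLinearMap.star_eq_adjoint, ContinuousLinearMap.adjoint_inner_right]
    change ⟪((y : H →L[ℂ] H) * g) u, v⟫_ℂ = _
    rw [h1]
    rfl

/-- A normal functional is given on forms of self-adjoint elements by a series which converges
uniformly on the unit ball; hence its level sets are closed there. -/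
theorem IsNormal.exists_continuousOn {M : VonNeumannAlgebra H} {φ : M.toStarSubalgebra → ℂ}
    (hφ : M.IsNormal φ) : ∃ Φ : (H × H → ℂ) → ℂ, ContinuousOn Φ M.ballForms ∧
      ∀ y : M.toStarSubalgebra, IsSelfAdjoint y → φ y = Φ (M.sesqForm y) := by
  obtain ⟨ξ, η, hξ, hη, h⟩ := hφ
  refine ⟨fun B => ∑' n, B (η n, ξ n), ?_, fun y hy => ?_⟩
  · refine continuousOn_tsum (u := fun n => ‖ξ n‖ ^ 2 + ‖η n‖ ^ 2) (fun n => by fun_prop)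
      (hξ.add hη) fun n B hB => (hB.1 _).trans ?_
    dsimp only
    nlinarith [sq_nonneg (‖ξ n‖ - ‖η n‖), sq_nonneg (‖ξ n‖), sq_nonneg ‖η n‖]
  · have hs' : IsSelfAdjoint (y : H →L[ℂ] H) := congrArg Subtype.val hy
    rw [← (h y).tsum_eq]
    refine tsum_congr fun n => ?_
    rw [sesqForm_apply, ← ContinuousLinearMap.adjoint_inner_right,
      ← ContinuousLinearMap.star_eq_adjoint, hs'.star_eq]

/-- Krein–Milman for slices of the self-adjoint unit ball of `M` by normal functionals. -/
theorem extremePoints_slice_nonempty (M : VonNeumannAlgebra H) {ι : Type*}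
    {φ : ι → M.toStarSubalgebra → ℂ} (hφ : ∀ i, M.IsNormal (φ i)) (c : ι → ℂ)
    (hne : {y : M.toStarSubalgebra | IsSelfAdjoint y ∧ ‖y‖ ≤ 1 ∧ ∀ i, φ i y = c i}.Nonempty) :
    ({y : M.toStarSubalgebra | IsSelfAdjoint y ∧ ‖y‖ ≤ 1 ∧
      ∀ i, φ i y = c i}.extremePoints ℝ).Nonempty := by
  set K := {y : M.toStarSubalgebra | IsSelfAdjoint y ∧ ‖y‖ ≤ 1 ∧ ∀ i, φ i y = c i} with hK
  choose Φ hΦ hφΦ using fun i => (hφ i).exists_continuousOn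
  have himg : M.sesqForm '' K = M.ballForms ∩ ⋂ i, (M.ballForms ∩ Φ i ⁻¹' {c i}) := by
    ext B
    constructor
    · rintro ⟨y, ⟨hs, hn, hy⟩, rfl⟩
      have hb := M.sesqForm_mem_ballForms hs hn
      exact ⟨hb, Set.mem_iInter.2 fun i => ⟨hb, by simp [← hφΦ i y hs, hy i]⟩⟩
    · rintro ⟨hB, hBi⟩
      obtain ⟨y, hs, hn, rfl⟩ := M.exists_sesqForm_eq hB
      refine ⟨y, ⟨hs, hn, fun i => ?_⟩, rfl⟩
      rw [hφΦ i y hs]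
      exact (Set.mem_iInter.1 hBi i).2
  have hcomp : IsCompact (M.sesqForm '' K) := by
    rw [himg]
    exact M.isCompact_ballForms.inter_right (isClosed_iInter fun i =>
      (hΦ i).preimage_isClosed_of_isClosed M.isCompact_ballForms.isClosed isClosed_singleton)
  obtain ⟨B, hB⟩ := hcomp.extremePoints_nonempty (hne.image _)
  obtain ⟨⟨y, hy, rfl⟩, hext⟩ := mem_extremePoints_iff_left.1 hB
  refine ⟨y, mem_extremePoints_iff_left.2 ⟨hy, fun x₁ h₁ x₂ h₂ hx => ?_⟩⟩
  refine M.sesqForm_injective (hext _ ⟨x₁, h₁, rfl⟩ _ ⟨x₂, h₂, rfl⟩ ?_)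
  rw [← LinearMap.coe_toAffineMap, ← image_openSegment]
  exact ⟨y, hx, rfl⟩

end VonNeumannAlgebra

/-! ### Greedy approximation by orthogonal symmetries -/

section Greedy

variable {A : Type*} [CStarAlgebra A]

theorem norm_le_one_of_mul_self_eq_one {s : A} (hs : IsSelfAdjoint s) (hss : s * s = 1) :
    ‖s‖ ≤ 1 := by
  have h := hs.norm_mul_self
  rw [hss] at h
  by_cases hA : Nontrivial A
  · rw [CStarRing.norm_one] at h
    exact (sq_le_one_iff₀ (norm_nonneg s)).1 h.ge
  · rw [not_nontrivial_iff_subsingleton] at hA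
    simp [Subsingleton.elim s 0]

variable [PartialOrder A] (τ : A →ₚ[ℂ] ℂ)

/-- A finite set of symmetries (self-adjoint unitaries), pairwise orthogonal for `τ`. -/
structure IsSymmetrySystem (T : Finset A) : Prop where
  isSelfAdjoint : ∀ s ∈ T, IsSelfAdjoint s
  mul_self : ∀ s ∈ T, s * s = 1
  orthogonal : ∀ s ∈ T, ∀ t ∈ T, s ≠ t → τ (s * t) = 0

/-- `a` minus its orthogonal projection to the span of a system `T` of symmetries. The coefficient
`τ (s * a)` is `⟨â, ŝ⟩`, as `s` is self-adjoint. -/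
noncomputable def symmResidual (T : Finset A) (a : A) : A := a - ∑ s ∈ T, τ (s * a) • s

variable {τ} {T : Finset A} {a : A}

theorem map_mul_symmResidual_of_orthogonal {t : A} (ht : ∀ s ∈ T, τ (t * s) = 0) :
    τ (t * symmResidual τ T a) = τ (t * a) := by
  rw [symmResidual, mul_sub, map_sub, Finset.mul_sum, map_sum, Finset.sum_eq_zero, sub_zero]
  intro s hs
  rw [mul_smul_comm, map_smul, ht s hs, smul_zero]

theorem map_mul_symmResidual_of_mem (h1 : τ 1 = 1) (hT : IsSymmetrySystem τ T) {t : A}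
    (ht : t ∈ T) :
    τ (t * symmResidual τ T a) = 0 := by
  rw [symmResidual, mul_sub, map_sub, Finset.mul_sum, map_sum, Finset.sum_eq_single_of_mem t ht]
  · rw [mul_smul_comm, map_smul, hT.mul_self t ht, h1, smul_eq_mul, mul_one, sub_self]
  · intro s hs hst
    rw [mul_smul_comm, map_smul, hT.orthogonal t ht s hs hst.symm, smul_zero]

theorem IsSymmetrySystem.insert_of_orthogonal [DecidableEq A] (htr : ∀ x y, τ (x * y) = τ (y * x))
    (hT : IsSymmetrySystem τ T) {s : A}
    (hs : IsSelfAdjoint s) (hss : s * s = 1) (ho : ∀ t ∈ T, τ (s * t) = 0) :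
    IsSymmetrySystem τ (insert s T) where
  isSelfAdjoint := Finset.forall_mem_insert _ _ _ |>.2 ⟨hs, hT.isSelfAdjoint⟩
  mul_self := Finset.forall_mem_insert _ _ _ |>.2 ⟨hss, hT.mul_self⟩
  orthogonal := by
    intro u hu v hv huv
    rcases Finset.mem_insert.1 hu with rfl | hu' <;> rcases Finset.mem_insert.1 hv with rfl | hv'
    · exact absurd rfl huv
    · exact ho v hv'
    · rw [htr]; exact ho u hu'
    · exact hT.orthogonal u hu' v hv' huv

theorem symmResidual_insert [DecidableEq A] {s : A} (hs : s ∉ T) :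
    symmResidual τ (insert s T) a = symmResidual τ T a - τ (s * a) • s := by
  rw [symmResidual, symmResidual, Finset.sum_insert hs]
  abel

variable (τ) in
/-- The conclusion of the noncommutative Lyapunov theorem: every self-adjoint contraction has the
same values as some symmetry under finitely many functionals `τ(· f)`, where the `f` are
self-adjoint. -/
def HasLyapunovProperty : Prop :=
  ∀ F : Finset A, (∀ f ∈ F, IsSelfAdjoint f) → ∀ x : A, IsSelfAdjoint x → ‖x‖ ≤ 1 →
    ∃ s : A, IsSelfAdjoint s ∧ s * s = 1 ∧ ∀ f ∈ F, τ (s * f) = τ (x * f)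

theorem IsSymmetrySystem.exists_insert [DecidableEq A] (hL : HasLyapunovProperty τ) (h1 : τ 1 = 1)
    (htr : ∀ x y, τ (x * y) = τ (y * x)) (hT : IsSymmetrySystem τ T) :
    ∃ s ∉ T, IsSymmetrySystem τ (insert s T) := by
  obtain ⟨s, hs, hss, hsf⟩ := hL T hT.isSelfAdjoint 0 (.zero A) (by simp)
  refine ⟨s, fun hmem => ?_, hT.insert_of_orthogonal htr hs hss fun t ht => by simpa using hsf t ht⟩
  have := hsf s hmem
  rw [hss, h1] at this
  simp at this

variable [StarOrderedRing A]

theorem re_map_mul_of_trace (htr : ∀ x y, τ (x * y) = τ (y * x)) {x y : A}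
    (hx : IsSelfAdjoint x) (hy : IsSelfAdjoint y) : ((τ (x * y)).re : ℂ) = τ (x * y) := by
  refine Complex.conj_eq_iff_re.1 ?_
  have := map_mul_eq_star_of_trace htr hy x
  rw [hx.star_eq] at this
  exact this.symm

theorem isSelfAdjoint_symmResidual (htr : ∀ x y, τ (x * y) = τ (y * x)) (hT : IsSymmetrySystem τ T)
    (ha : IsSelfAdjoint a) : IsSelfAdjoint (symmResidual τ T a) := by
  refine ha.sub (isSelfAdjoint_sum T fun s hs => ?_)
  rw [← re_map_mul_of_trace htr (hT.isSelfAdjoint s hs) ha, Complex.coe_smul]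
  exact (IsSelfAdjoint.all _).smul (hT.isSelfAdjoint s hs)

/-- The new symmetry can be given any coefficient `c ≤ ‖r‖₂² / ‖r‖` against `a`, where `r` is the
residual of `a`. -/
theorem IsSymmetrySystem.exists_insert_of_le [DecidableEq A] (hL : HasLyapunovProperty τ)
    (h1 : τ 1 = 1) (htr : ∀ x y, τ (x * y) = τ (y * x)) (hT : IsSymmetrySystem τ T)
    (ha : IsSelfAdjoint a) {c : ℝ} (hc : 0 ≤ c)
    (hpos : 0 < (τ (symmResidual τ T a * symmResidual τ T a)).re)
    (hle : c * ‖symmResidual τ T a‖ ≤ (τ (symmResidual τ T a * symmResidual τ T a)).re) :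
    ∃ s ∉ T, IsSymmetrySystem τ (insert s T) ∧ IsSelfAdjoint s ∧ s * s = 1 ∧
      τ (s * symmResidual τ T a) = c ∧ τ (s * a) = c := by
  set r := symmResidual τ T a with hr
  set E := (τ (r * r)).re with hE
  have hrs : IsSelfAdjoint r := isSelfAdjoint_symmResidual htr hT ha
  have hEr : τ (r * r) = E := (re_map_mul_of_trace htr hrs hrs).symm
  obtain ⟨s, hs, hss, hsf⟩ := hL (insert r T)
    (Finset.forall_mem_insert _ _ _ |>.2 ⟨hrs, hT.isSelfAdjoint⟩) ((c / E) • r)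
    ((IsSelfAdjoint.all _).smul hrs) (by
      rw [norm_smul, Real.norm_of_nonneg (by positivity), div_mul_eq_mul_div]
      exact div_le_one_of_le₀ hle hpos.le)
  have hval : ∀ f, τ ((c / E) • r * f) = (c / E : ℝ) * τ (r * f) := fun f => by
    rw [smul_mul_assoc, ← Complex.coe_smul, map_smul, smul_eq_mul]
  have ho : ∀ t ∈ T, τ (s * t) = 0 := fun t ht => by
    rw [hsf t (Finset.mem_insert_of_mem ht), hval, htr, map_mul_symmResidual_of_mem h1 hT ht,
      mul_zero]
  have hsr : τ (s * r) = c := by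
    rw [hsf r (Finset.mem_insert_self _ _), hval, hEr, ← Complex.ofReal_mul,
      div_mul_cancel₀ _ hpos.ne']
  refine ⟨s, fun hmem => ?_, hT.insert_of_orthogonal htr hs hss ho, hs, hss, hsr, ?_⟩
  · have := ho s hmem
    rw [hss, h1] at this
    exact one_ne_zero this
  · rw [← hsr, hr, map_mul_symmResidual_of_orthogonal ho]

/-- Greedy approximation. Choosing the `n`-th coefficient to be `κ / √(n + 1)`, the operator norm
of the residual stays below `N + 2κ√n`, which keeps the choice admissible as long as the squared
`L²`-norm of the residual is at least `ε`, whereas the latter drops by `κ² / (n + 1)`. As the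
harmonic series diverges, it falls below `ε`. -/
theorem IsSymmetrySystem.exists_symmResidual_lt (hL : HasLyapunovProperty τ)
    (h1 : τ 1 = 1) (htr : ∀ x y, τ (x * y) = τ (y * x)) (hT : IsSymmetrySystem τ T)
    (ha : IsSelfAdjoint a) {ε : ℝ} (hε : 0 < ε) :
    ∃ T', T ⊆ T' ∧ IsSymmetrySystem τ T' ∧
      (τ (symmResidual τ T' a * symmResidual τ T' a)).re < ε := by
  classical
  by_contra! hcon
  set N := ‖symmResidual τ T a‖ with hN
  set E := (τ (symmResidual τ T a * symmResidual τ T a)).re with hE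
  have hN0 : 0 ≤ N := norm_nonneg _
  -- `κ` is so small that `κ / √(n + 1) * (N + 2κ√n) ≤ κN + 2κ² ≤ ε` for all `n`
  set κ : ℝ := min 1 (ε / (N + 2)) with hκ
  have hκpos : 0 < κ := lt_min one_pos (by positivity)
  have hκε : κ * N + 2 * κ ^ 2 ≤ ε := by
    have h2 : κ ≤ 1 := min_le_left _ _
    have h3 : κ * (N + 2) ≤ ε := (le_div_iff₀ (by positivity)).1 (min_le_right _ _)
    nlinarith
  have main : ∀ n : ℕ, ∃ T', T ⊆ T' ∧ IsSymmetrySystem τ T' ∧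
      ‖symmResidual τ T' a‖ ≤ N + 2 * κ * √n ∧
      (τ (symmResidual τ T' a * symmResidual τ T' a)).re ≤
        E - κ ^ 2 * ∑ i ∈ Finset.range n, 1 / ((i : ℝ) + 1) := by
    intro n
    induction n with
    | zero => exact ⟨T, subset_rfl, hT, by simp [hN], by simp [hE]⟩
    | succ n ih =>
      obtain ⟨T', hTT', hT', hnorm, hen⟩ := ih
      set r := symmResidual τ T' a with hr
      have hεr : ε ≤ (τ (r * r)).re := hcon T' hTT' hT'
      set q := √((n : ℝ) + 1) with hq
      have hq1 : 1 ≤ q := Real.one_le_sqrt.2 (by linarith [n.cast_nonneg (α := ℝ)])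
      have hqq : q ^ 2 = n + 1 := Real.sq_sqrt (by positivity)
      have hp0 : 0 ≤ √(n : ℝ) := Real.sqrt_nonneg _
      have hpq : √(n : ℝ) ≤ q := Real.sqrt_le_sqrt (by linarith)
      have hpp : √(n : ℝ) ^ 2 = n := Real.sq_sqrt (by positivity)
      have hq0 : 0 < q := by linarith
      obtain ⟨s, hsT, hins, hs, hss, hsr, hsa⟩ := hT'.exists_insert_of_le (c := κ / q) hL h1 htr ha
        (by positivity) (hε.trans_le hεr) (by
          refine le_trans ?_ (hκε.trans hεr)
          calc κ / q * ‖r‖ ≤ κ / q * (N + 2 * κ * √n) := by gcongr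
            _ = κ / q * N + 2 * κ ^ 2 * (√n / q) := by ring
            _ ≤ κ * N + 2 * κ ^ 2 * 1 := by
              gcongr
              · exact div_le_self hκpos.le hq1
              · exact div_le_one_of_le₀ hpq hq0.le
            _ = _ := by ring)
      rw [← hr] at hsr
      have hres : symmResidual τ (insert s T') a = r - (κ / q) • s := by
        rw [symmResidual_insert hsT, hsa, Complex.coe_smul]
      refine ⟨insert s T', hTT'.trans (Finset.subset_insert _ _), hins, ?_, ?_⟩
      · rw [hres]
        calc ‖r - (κ / q) • s‖ ≤ ‖r‖ + ‖(κ / q) • s‖ := norm_sub_le _ _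
          _ ≤ (N + 2 * κ * √n) + κ / q * 1 := by
            rw [norm_smul, Real.norm_of_nonneg (by positivity)]
            gcongr
            exact norm_le_one_of_mul_self_eq_one hs hss
          _ = N + κ * (2 * √n + 1 / q) := by ring
          _ ≤ N + κ * (2 * q) := by
            gcongr
            rw [← le_sub_iff_add_le', div_le_iff₀ hq0]
            nlinarith [sq_nonneg (q - √n)]
          _ = N + 2 * κ * √((n + 1 : ℕ) : ℝ) := by push_cast; ring
      · have hsq : τ ((r - (κ / q) • s) * (r - (κ / q) • s)) = τ (r * r) - ((κ / q) ^ 2 : ℝ) := by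
          simp only [sub_mul, mul_sub, mul_smul_comm, smul_mul_assoc, hss, map_sub,
            ← Complex.coe_smul, map_smul, htr r s, hsr, h1, smul_eq_mul]
          push_cast
          ring
        rw [hres, hsq, Complex.sub_re, Complex.ofReal_re, Finset.sum_range_succ, mul_add, div_pow,
          hqq, mul_one_div]
        linarith
  have htend := Real.tendsto_sum_range_one_div_nat_succ_atTop
  obtain ⟨n, hn⟩ := (htend.eventually_gt_atTop (E / κ ^ 2)).exists
  obtain ⟨T', hTT', hT', -, hen⟩ := main n
  have h2 := hcon T' hTT' hT'
  rw [div_lt_iff₀ (by positivity)] at hn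
  nlinarith

end Greedy

/-! ### Symmetries and separability in the presence of a normal faithful trace -/

namespace VonNeumannAlgebra

variable {H : Type*} [NormedAddCommGroup H] [InnerProductSpace ℂ H] [CompleteSpace H]
  {M : VonNeumannAlgebra H} {τ : M.toStarSubalgebra →ₚ[ℂ] ℂ}

theorem IsNormal.mul_right {φ : M.toStarSubalgebra → ℂ} (hφ : M.IsNormal φ)
    (a : M.toStarSubalgebra) : M.IsNormal fun x => φ (x * a) := by
  obtain ⟨ξ, η, hξ, hη, h⟩ := hφ
  refine ⟨fun n => (a : H →L[ℂ] H) (ξ n), η, ?_, hη, fun x => h (x * a)⟩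
  refine (hξ.mul_left (‖(a : H →L[ℂ] H)‖ ^ 2)).of_nonneg_of_le (fun n => by positivity) fun n => ?_
  rw [← mul_pow]
  gcongr
  exact (a : H →L[ℂ] H).le_opNorm _

/-- A noncommutative Lyapunov theorem: an extreme point of the slice through `x` is a symmetry. -/
theorem IsNormalFaithfulTrace.hasLyapunovProperty (hτ : M.IsNormalFaithfulTrace τ)
    (hA : ∀ e : M.toStarSubalgebra, M.IsAbelianProjection e → e = 0) :
    HasLyapunovProperty τ := by
  intro F hF x hx hxn
  obtain ⟨y, hy⟩ := M.extremePoints_slice_nonempty (ι := F)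
    (φ := fun f y => τ (y * (f : M.toStarSubalgebra)))
    (fun f => hτ.normal.mul_right _) (fun f => τ (x * f)) ⟨x, hx, hxn, fun _ => rfl⟩
  obtain ⟨hs, -, hyf⟩ := extremePoints_subset hy
  exact ⟨y, hs, mul_self_eq_one_of_mem_extremePoints (ι := F) (f := Subtype.val)
    (fun e he hc => hA e ⟨he, hc⟩)
    hτ.map_mul_comm (fun f => hF f f.2) hy, fun f hf => hyf ⟨f, hf⟩⟩

variable (τ) in
/-- The functional `τ(a ·)`. -/
noncomputable def mulFunctional (a : M.toStarSubalgebra) : StrongDual ℂ M.toStarSubalgebra :=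
  (ContinuousLinearMap.mk τ.toLinearMap (map_continuous τ)) ∘L
    ContinuousLinearMap.mul ℂ M.toStarSubalgebra a

theorem mulFunctional_apply (a x : M.toStarSubalgebra) : mulFunctional τ a x = τ (a * x) := rfl

/-- On the unit ball, `‖x - a‖₂² ≤ 2 ‖τ(x ·) - τ(a ·)‖`, so that separability of the predual passes
to the `L²`-norm. -/
theorem IsNormalFaithfulTrace.exists_seq_dense (hτ : M.IsNormalFaithfulTrace τ)
    (hsep : M.IsSeparable) : ∃ a : ℕ → M.toStarSubalgebra, (∀ n, IsSelfAdjoint (a n)) ∧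
      ∀ x, IsSelfAdjoint x → ‖x‖ ≤ 1 → ∀ ε > 0, ∃ n, (τ ((x - a n) * (x - a n))).re < ε := by
  set B : Set M.toStarSubalgebra := {x | IsSelfAdjoint x ∧ ‖x‖ ≤ 1} with hB
  have hBsep : TopologicalSpace.IsSeparable (mulFunctional τ '' B) := by
    refine hsep.mono ?_
    rintro _ ⟨a, -, rfl⟩
    change M.IsNormal _
    have : (mulFunctional τ a : M.toStarSubalgebra → ℂ) = fun x => τ (x * a) :=
      funext fun x => hτ.map_mul_comm a x
    rw [this]
    exact hτ.normal.mul_right a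
  obtain ⟨t, htB, htc, hBt⟩ := hBsep.exists_countable_dense_subset
  have h0 : (mulFunctional τ '' B).Nonempty := ⟨_, 0, ⟨.zero _, by simp⟩, rfl⟩
  have htne : t.Nonempty := closure_nonempty_iff.1 (h0.mono hBt)
  obtain ⟨φ, rfl⟩ := htc.exists_eq_range htne
  choose a ha haφ using fun n => htB ⟨n, rfl⟩
  refine ⟨a, fun n => (ha n).1, fun x hx hxn ε hε => ?_⟩
  obtain ⟨_, ⟨n, rfl⟩, hn⟩ := Metric.mem_closure_iff.1 (hBt ⟨x, ⟨hx, hxn⟩, rfl⟩)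
    (ε / 2) (half_pos hε)
  refine ⟨n, ?_⟩
  rw [← haφ n, dist_eq_norm] at hn
  have h1 : τ ((x - a n) * (x - a n)) = (mulFunctional τ x - mulFunctional τ (a n)) (x - a n) := by
    rw [sub_apply, mulFunctional_apply, mulFunctional_apply, ← map_sub, ← sub_mul]
  have h2 : ‖x - a n‖ ≤ 2 := (norm_sub_le _ _).trans (by linarith [(ha n).2])
  calc (τ ((x - a n) * (x - a n))).re ≤ ‖τ ((x - a n) * (x - a n))‖ := Complex.re_le_norm _
    _ ≤ ‖mulFunctional τ x - mulFunctional τ (a n)‖ * ‖x - a n‖ := by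
      rw [h1]; exact ContinuousLinearMap.le_opNorm _ _
    _ ≤ ‖mulFunctional τ x - mulFunctional τ (a n)‖ * 2 := by gcongr
    _ < ε := by linarith

/-! ### Vectors of the Hilbert space represented by operators -/

theorem inner_hat (x y : M.toStarSubalgebra) : ⟪M.hat τ x, M.hat τ y⟫_ℂ = τ (star x * y) := by
  rw [hat, hat, UniformSpace.Completion.inner_coe]
  rfl

theorem norm_hat_sq {x : M.toStarSubalgebra} (hx : IsSelfAdjoint x) :
    ‖M.hat τ x‖ ^ 2 = (τ (x * x)).re := by
  rw [← inner_self_eq_norm_sq (𝕜 := ℂ), inner_hat, hx.star_eq]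
  rfl

variable (M τ) in
/-- `x ↦ x̂` as a linear map. -/
noncomputable def hatLinearMap : M.toStarSubalgebra →ₗ[ℂ] M.L2 τ :=
  (UniformSpace.Completion.toComplL (𝕜 := ℂ) (E := τ.PreGNS)).toLinearMap ∘ₗ
    τ.toPreGNS.toLinearMap

theorem hatLinearMap_apply (x : M.toStarSubalgebra) : hatLinearMap M τ x = M.hat τ x := rfl

theorem hat_sub (x y : M.toStarSubalgebra) : M.hat τ (x - y) = M.hat τ x - M.hat τ y :=
  map_sub (hatLinearMap M τ) x y

theorem isTraceVector_hat (htr : ∀ x y, τ (x * y) = τ (y * x)) {s : M.toStarSubalgebra}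
    (hs : IsSelfAdjoint s) (hss : s * s = 1) : M.IsTraceVector τ (M.hat τ s) := by
  intro x
  have h : τ.gnsStarAlgHom x (M.hat τ s) = M.hat τ (x * s) :=
    τ.gnsNonUnitalStarAlgHom_apply_coe
  rw [h, inner_hat, hs.star_eq, htr, mul_assoc, hss, mul_one]

/-- A closed subspace of `L²(M, τ)` which approximates the vectors of an `L²`-dense sequence of the
self-adjoint unit ball is everything. -/
theorem eq_top_of_hat_mem {W : Submodule ℂ (M.L2 τ)} (hW : IsClosed (W : Set (M.L2 τ)))
    {a : ℕ → M.toStarSubalgebra} (ha : ∀ n, IsSelfAdjoint (a n))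
    (hdense : ∀ x, IsSelfAdjoint x → ‖x‖ ≤ 1 → ∀ ε > 0, ∃ n, (τ ((x - a n) * (x - a n))).re < ε)
    (hmem : ∀ n, M.hat τ (a n) ∈ W) : W = ⊤ := by
  have hball : ∀ x, IsSelfAdjoint x → ‖x‖ ≤ 1 → M.hat τ x ∈ W := by
    intro x hx hxn
    rw [← SetLike.mem_coe, ← hW.closure_eq, Metric.mem_closure_iff]
    intro ε hε
    obtain ⟨n, hn⟩ := hdense x hx hxn (ε ^ 2) (by positivity)
    refine ⟨_, hmem n, ?_⟩
    rw [← norm_hat_sq (hx.sub (ha n)), hat_sub] at hn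
    rw [dist_eq_norm]
    exact lt_of_pow_lt_pow_left₀ 2 hε.le hn
  have hsa : ∀ x, IsSelfAdjoint x → M.hat τ x ∈ W := by
    intro x hx
    by_cases h0 : x = 0
    · rw [h0, ← hatLinearMap_apply, map_zero]
      exact W.zero_mem
    have hpos : 0 < ‖x‖ := norm_pos_iff.2 h0
    have h1 := hball (‖x‖⁻¹ • x) ((IsSelfAdjoint.all _).smul hx) (by
      rw [norm_smul, norm_inv, norm_norm, inv_mul_cancel₀ hpos.ne'])
    have h2 : x = (‖x‖ : ℂ) • (‖x‖⁻¹ • x) := by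
      rw [Complex.coe_smul, smul_smul, mul_inv_cancel₀ hpos.ne', one_smul]
    rw [h2, ← hatLinearMap_apply, map_smul]
    exact W.smul_mem _ h1
  have hall : ∀ x, M.hat τ x ∈ W := by
    intro x
    rw [← realPart_add_I_smul_imaginaryPart x, ← hatLinearMap_apply, map_add, map_smul]
    exact W.add_mem (hsa _ (realPart x).2) (W.smul_mem _ (hsa _ (imaginaryPart x).2))
  refine (Submodule.eq_top_iff').2 fun ξ => ?_
  induction ξ using UniformSpace.Completion.induction_on with
  | hp => exact hW
  | ih b => exact hall (τ.ofPreGNS b)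

/-! ### The orthonormal basis -/

/-- Interleaving the approximations of the terms of a sequence `a` yields an increasing sequence of
systems of symmetries, whose union spans vectors arbitrarily close to each `a k`. -/
theorem exists_infinite_symmetries (hL : HasLyapunovProperty τ) (h1 : τ 1 = 1)
    (htr : ∀ x y, τ (x * y) = τ (y * x)) {a : ℕ → M.toStarSubalgebra}
    (ha : ∀ n, IsSelfAdjoint (a n)) :
    ∃ U : Set M.toStarSubalgebra, U.Infinite ∧ U.Countable ∧
      (∀ s ∈ U, IsSelfAdjoint s ∧ s * s = 1) ∧ (∀ s ∈ U, ∀ t ∈ U, s ≠ t → τ (s * t) = 0) ∧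
      ∀ k, M.hat τ (a k) ∈ (Submodule.span ℂ (M.hat τ '' U)).topologicalClosure := by
  classical
  have step : ∀ (n : ℕ) (T : {T : Finset M.toStarSubalgebra // IsSymmetrySystem τ T}),
      ∃ T' : {T : Finset M.toStarSubalgebra // IsSymmetrySystem τ T}, T.1 ⊂ T'.1 ∧
        (τ (symmResidual τ T'.1 (a n.unpair.1) * symmResidual τ T'.1 (a n.unpair.1))).re <
          1 / ((n : ℝ) + 1) := by
    rintro n ⟨T, hT⟩
    obtain ⟨s, hs, hT1⟩ := hT.exists_insert hL h1 htr
    obtain ⟨T', hTT', hT', hlt⟩ := hT1.exists_symmResidual_lt hL h1 htr (ha n.unpair.1)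
      (ε := 1 / ((n : ℝ) + 1)) (by positivity)
    exact ⟨⟨T', hT'⟩, (Finset.ssubset_insert hs).trans_subset hTT', hlt⟩
  choose next hnext hres using step
  let T : ℕ → {T : Finset M.toStarSubalgebra // IsSymmetrySystem τ T} :=
    Nat.rec ⟨∅, by simp, by simp, by simp⟩ next
  have hTsucc : ∀ n, T (n + 1) = next n (T n) := fun _ => rfl
  have hmono : StrictMono fun n => (T n).1 := strictMono_nat_of_lt_succ fun n => hnext n (T n)
  have hcard : ∀ n, n ≤ (T n).1.card :=
    fun _ => StrictMono.le_apply (f := fun n => (T n).1.card)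
      fun m n h => Finset.card_lt_card (hmono h)
  refine ⟨⋃ n, ((T n).1 : Set M.toStarSubalgebra), fun hfin => ?_,
    Set.countable_iUnion fun n => (T n).1.countable_toSet, fun s hs => ?_, fun s hs t ht => ?_,
    fun k => ?_⟩
  · have h2 : ∀ n, n ≤ hfin.toFinset.card := fun n => (hcard n).trans
      (Finset.card_le_card fun x hx => by
        simpa using ⟨n, hx⟩)
    exact absurd (h2 (hfin.toFinset.card + 1)) (by omega)
  · obtain ⟨n, hn⟩ := Set.mem_iUnion.1 hs
    exact ⟨(T n).2.isSelfAdjoint s hn, (T n).2.mul_self s hn⟩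
  · obtain ⟨m, hm⟩ := Set.mem_iUnion.1 hs
    obtain ⟨n, hn⟩ := Set.mem_iUnion.1 ht
    exact (T (max m n)).2.orthogonal s (hmono.monotone (le_max_left m n) hm) t
      (hmono.monotone (le_max_right m n) hn)
  · rw [← SetLike.mem_coe, Submodule.topologicalClosure_coe, Metric.mem_closure_iff]
    intro ε hε
    obtain ⟨m, hm⟩ := exists_nat_one_div_lt (sq_pos_of_pos hε)
    -- the term `a k` is the target of all steps `Nat.pair k m`, which are at least `m`
    set n := Nat.pair k m with hn
    have hmn : m ≤ n := Nat.right_le_pair k m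
    have hlt := hres n (T n)
    rw [← hTsucc, hn, Nat.unpair_pair, ← hn] at hlt
    set S := T (n + 1) with hS
    have hsa := isSelfAdjoint_symmResidual htr S.2 (ha k)
    rw [← norm_hat_sq hsa] at hlt
    refine ⟨M.hat τ (∑ s ∈ S.1, τ (s * a k) • s), ?_, ?_⟩
    · rw [← hatLinearMap_apply, map_sum]
      refine Submodule.sum_mem _ fun s hs => ?_
      rw [map_smul]
      exact Submodule.smul_mem _ _ (Submodule.subset_span ⟨s, Set.mem_iUnion.2 ⟨n + 1, hs⟩, rfl⟩)
    · rw [dist_eq_norm, ← hat_sub]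
      refine lt_of_pow_lt_pow_left₀ 2 hε.le (hlt.trans_le (le_trans ?_ hm.le))
      exact one_div_le_one_div_of_le (by positivity) (by gcongr)

end VonNeumannAlgebra

theorem mainTheorem2 {H : Type*} [NormedAddCommGroup H] [InnerProductSpace ℂ H] [CompleteSpace H]
    (M : VonNeumannAlgebra H) (hsep : M.IsSeparable) (hM : M.IsTypeIIOneFactor)
    (τ : M.toStarSubalgebra →ₚ[ℂ] ℂ) (hτ : M.IsNormalFaithfulTrace τ) :
    ∃ (s : ℕ → M.toStarSubalgebra) (b : HilbertBasis ℕ ℂ (M.L2 τ)),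
      ∀ n, IsSelfAdjoint (s n) ∧ s n ∈ unitary M.toStarSubalgebra ∧
        b n = M.hat τ (s n) ∧ M.IsTraceVector τ (b n) := by
  have htr := hτ.map_mul_comm
  obtain ⟨a, ha, hdense⟩ := hτ.exists_seq_dense hsep
  obtain ⟨U, hUinf, hUc, hUs, hUo, hUa⟩ := VonNeumannAlgebra.exists_infinite_symmetries
    (hτ.hasLyapunovProperty hM.2.2) hτ.map_one htr ha
  have : Infinite U := hUinf.to_subtype
  have : Countable U := hUc.to_subtype
  obtain ⟨e⟩ : Nonempty (ℕ ≃ U) := by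
    obtain ⟨hden⟩ := nonempty_denumerable U
    exact ⟨(Denumerable.eqv U).symm⟩
  have horth : Orthonormal ℂ fun n => M.hat τ (e n) := by
    rw [orthonormal_iff_ite]
    intro i j
    rw [VonNeumannAlgebra.inner_hat, (hUs _ (e i).2).1.star_eq]
    split_ifs with hij
    · rw [hij, (hUs _ (e j).2).2, hτ.map_one]
    · exact hUo _ (e i).2 _ (e j).2 fun h => hij (e.injective (Subtype.ext h))
  have hrange : Set.range (fun n => M.hat τ (e n)) = M.hat τ '' U := by
    have h := e.surjective.range_comp fun u : U => M.hat τ u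
    rw [show (fun n => M.hat τ (e n)) = (fun u : U => M.hat τ u) ∘ e from rfl, h,
      ← Set.image_eq_range]
  have htop : (Submodule.span ℂ (Set.range fun n => M.hat τ (e n))).topologicalClosure = ⊤ := by
    rw [hrange]
    exact VonNeumannAlgebra.eq_top_of_hat_mem (Submodule.isClosed_topologicalClosure _) ha hdense
      hUa
  refine ⟨fun n => e n, HilbertBasis.mk horth htop.ge, fun n => ?_⟩
  obtain ⟨hs, hss⟩ := hUs _ (e n).2
  have hb : HilbertBasis.mk horth htop.ge n = M.hat τ (e n) :=
    congrFun (HilbertBasis.coe_mk horth htop.ge) n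
  refine ⟨hs, Unitary.mem_iff.2 ⟨?_, ?_⟩, hb, ?_⟩
  · rw [hs.star_eq, hss]
  · rw [hs.star_eq, hss]
  · rw [hb]
    exact VonNeumannAlgebra.isTraceVector_hat htr hs hss
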